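/- **Theorem 8.5.** A full binary tree is a plane rooted tree in which every node has $0$ or $2$ children. Its compacted form is the directed acyclic graph obtained by traversing the tree in post-order and replacing every edge that leads to a (fringe) subtree which has already been seen during the traversal by a pointer to the existing copy of that subtree; in particular only the first leaf is kept. A *compacted binary tree* is a graph obtained in this way from some full binary tree; its *size* is the number of its internal nodes. Its *spine* is the binary tree (each node having an optional left and an optional right child) obtained by deleting all pointers and the leaf, and its *right height* is the maximal number of right edges on a path in the spine from the root to a node (it is $0$ if the spine is empty). For $k,n\ge 0$ let $c_{k,n}$ be the number of compacted binary trees of size $n$ and right height at most $k$, and let $$C_k(z)=\sum_{n\ge 0} c_{k,n}\frac{z^n}{n!}$$ be the corresponding exponential generating function, a formal power series. Let $D=\frac{d}{dz}$, let $z$ denote the operator of multiplication by $z$, let $1$ be the identity operator, and let products of operators denote composition (so that $(D\cdot z)F=\frac{d}{dz}(zF)$). Define differential operators $(M_k)_{k\ge 0}$ by $$M_0=(1-z)D-1,\qquad M_1=(1-2z)D^2-(3-z)D,$$ $$M_k=M_{k-1}\cdot D-M_{k-2}\cdot\left(D^2\cdot z-z\cdot D\right)\qquad (k\ge 2).$$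 Then, for every $k\ge 0$, $$M_k\cdot C_k=0 .$$ -/

import Mathlib

/-- Full binary trees, every node having either 0 or 2 children: `BinaryTree.nil` is a leaf,
and `BinaryTree.node () l r` is an internal node with left child `l` and right child `r`. -/
abbrev FullBinaryTree : Type := BinaryTree Unit

/-- Plane rooted DAGs with a distinguished spine. The nodes are the single leaf (node number `0`)
and the internal nodes, which are numbered `1, 2, 3, …` in post-order. An edge is either an edge
to a child (`leaf` or `node`), or a pointer to the node with a given number. The numbering is
determined by the unlabeled graph, so distinct compacted trees are distinct as unlabeled graphs. -/
inductive PointerTree : Type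
  | leaf : PointerTree
  | pointer (target : ℕ) : PointerTree
  | node (left right : PointerTree) : PointerTree

namespace PointerTree

/-- The size: the number of internal nodes. -/
def size : PointerTree → ℕ
  | leaf => 0
  | pointer _ => 0
  | node l r => size l + size r + 1

/-- The spine: delete all pointers and the leaf. What remains is a binary tree in which each node
has an optional left and an optional right child (`BinaryTree.nil` is the absence of a node). -/
def spine : PointerTree → BinaryTree Unit
  | leaf => .nil
  | pointer _ => .nil
  | node l r => .node () (spine l) (spine r)

end PointerTree

/-- The right height of a binary tree with optional children: the maximal number of right edges
on a path from the root to a node (`0` for the empty tree). -/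
def rightHeight : BinaryTree Unit → ℕ
  | .nil => 0
  | .node _ l .nil => rightHeight l
  | .node _ l (.node _ rl rr) => max (rightHeight l) (rightHeight (.node () rl rr) + 1)

/-- The global state of the UID procedure: the counter, the table that associates a unique
identifier to every pair (uid of left child, uid of right child) met so far, and whether the leaf
has already been met. -/
structure UIDState : Type where
  counter : ℕ
  table : List ((ℕ × ℕ) × ℕ)
  leafSeen : Bool

/-- The initial state: counter `0`, empty table. -/
def UIDState.init : UIDState := ⟨0, [], false⟩

/-- The UID procedure (post-order traversal) on a full binary tree. It returns the graph built
for the current subtree, the uid of the current subtree (`0` for a leaf), and the new state.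
A subtree that has already been seen is replaced by a pointer to the existing copy. -/
def uidProc : FullBinaryTree → UIDState → PointerTree × ℕ × UIDState
  | .nil, s =>
      (if s.leafSeen then .pointer 0 else .leaf, 0, { s with leafSeen := true })
  | .node _ l r, s =>
      let (cl, ul, s₁) := uidProc l s
      let (cr, ur, s₂) := uidProc r s₁
      match s₂.table.lookup (ul, ur) with
      | some v => (.pointer v, v, s₂)
      | none =>
          (.node cl cr, s₂.counter + 1,
            { s₂ with
              counter := s₂.counter + 1
              table := ((ul, ur), s₂.counter + 1) :: s₂.table })

/-- The compacted form of a full binary tree. -/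
def compaction (t : FullBinaryTree) : PointerTree := (uidProc t UIDState.init).1

/-- A compacted binary tree is a DAG computed by the UID procedure from a full binary tree. -/
def IsCompactedTree (c : PointerTree) : Prop := ∃ t : FullBinaryTree, compaction t = c

/-- The compacted trees of right height at most `k` and size `n`. -/
def compactedTrees (k n : ℕ) : Set PointerTree :=
  {c | IsCompactedTree c ∧ c.size = n ∧ rightHeight c.spine ≤ k}

/-- The number of compacted trees of right height at most `k` and size `n`; the set is finite by
`compactedTrees_finite` below. -/
noncomputable def numCompactedTrees (k n : ℕ) : ℕ := (compactedTrees k n).ncard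

/-- The exponential generating function of compacted trees of right height at most `k`. -/
noncomputable def compactedEGF (k : ℕ) : PowerSeries ℚ :=
  PowerSeries.mk fun n => (numCompactedTrees k n : ℚ) / (n.factorial : ℚ)

/-- The operator `d/dz` on formal power series. -/
noncomputable def opD : Module.End ℚ (PowerSeries ℚ) :=
  (PowerSeries.derivative ℚ : PowerSeries ℚ →ₗ[ℚ] PowerSeries ℚ)

/-- The operator of multiplication by `z` on formal power series. -/
noncomputable def opZ : Module.End ℚ (PowerSeries ℚ) :=
  LinearMap.mulLeft ℚ (PowerSeries.X : PowerSeries ℚ)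

/-- The differential operators `M_k`; products are compositions of operators. -/
noncomputable def opM : ℕ → Module.End ℚ (PowerSeries ℚ)
  | 0 => (1 - opZ) * opD - 1
  | 1 => (1 - 2 * opZ) * opD ^ 2 - (3 - opZ) * opD
  | k + 2 => opM (k + 1) * opD - opM k * (opD ^ 2 * opZ - opZ * opD)

/-- All pointers have target at most `m`. -/
def PointerTree.TargetsLE (m : ℕ) : PointerTree → Prop
  | leaf => True
  | pointer v => v ≤ m
  | node l r => l.TargetsLE m ∧ r.TargetsLE m

theorem PointerTree.TargetsLE.mono {m m' : ℕ} (h : m ≤ m') :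
    ∀ {c : PointerTree}, c.TargetsLE m → c.TargetsLE m'
  | leaf, _ => trivial
  | pointer _, hc => le_trans (show _ ≤ m from hc) h
  | node _ _, hc => ⟨hc.1.mono h, hc.2.mono h⟩

/-- The invariant of the UID procedure: in the table, children have smaller uids than parents. -/
def UIDState.Good (s : UIDState) : Prop :=
  ∀ a b v, s.table.lookup (a, b) = some v → a < v ∧ b < v ∧ v ≤ s.counter

theorem uidProc_spec (t : FullBinaryTree) : ∀ s : UIDState, s.Good →
    (uidProc t s).2.2.Good ∧
    (uidProc t s).2.1 ≤ (uidProc t s).2.2.counter ∧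
    (uidProc t s).1.TargetsLE (uidProc t s).2.2.counter ∧
    (uidProc t s).2.2.counter = s.counter + (uidProc t s).1.size ∧
    ((uidProc t s).2.2.counter = s.counter ∨
      (uidProc t s).2.1 = (uidProc t s).2.2.counter) := by
  induction t with
  | nil =>
    intro s hs
    refine ⟨hs, Nat.zero_le _, ?_, ?_, Or.inl rfl⟩
    · cases h : s.leafSeen <;> simp [uidProc, h, PointerTree.TargetsLE]
    · cases h : s.leafSeen <;> simp [uidProc, h, PointerTree.size]
  | node _ l r ihl ihr =>
    intro s hs
    obtain ⟨g1, u1, p1, c1, d1⟩ := ihl s hs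
    obtain ⟨g2, u2, p2, c2, d2⟩ := ihr _ g1
    simp only [uidProc]
    generalize uidProc l s = A at *
    obtain ⟨cl, ul, s₁⟩ := A
    generalize uidProc r s₁ = B at *
    obtain ⟨cr, ur, s₂⟩ := B
    dsimp only at *
    cases h : s₂.table.lookup (ul, ur) with
    | some v =>
      have hv := g2 _ _ _ h
      refine ⟨g2, hv.2.2, hv.2.2, ?_, Or.inl ?_⟩ <;> simp only [PointerTree.size] <;> omega
    | none =>
      refine ⟨?_, le_refl _, ⟨p1.mono (by dsimp only; omega), p2.mono (by dsimp only; omega)⟩,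
        ?_, Or.inr rfl⟩
      · intro a b v hv
        simp only [List.lookup_cons] at hv
        split at hv
        · rename_i heq
          simp only [beq_iff_eq, Prod.mk.injEq] at heq
          simp only [Option.some.injEq] at hv
          dsimp only
          omega
        · have := g2 _ _ _ hv
          dsimp only
          omega
      · simp only [PointerTree.size]
        omega

theorem PointerTree.finite_size_le (m n : ℕ) :
    {c : PointerTree | c.size ≤ n ∧ c.TargetsLE m}.Finite := by
  have base : ({leaf} ∪ pointer '' Set.Iic m : Set PointerTree).Finite :=
    (Set.finite_singleton _).union ((Set.finite_Iic m).image _)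
  induction n with
  | zero =>
    refine base.subset ?_
    rintro (_ | v | ⟨l, r⟩) ⟨h, ht⟩
    · simp
    · exact Or.inr ⟨v, ht, rfl⟩
    · simp [size] at h
  | succ n ih =>
    refine (base.union (Set.Finite.image2 node ih ih)).subset ?_
    rintro (_ | v | ⟨l, r⟩) ⟨h, ht⟩
    · simp
    · exact Or.inl (Or.inr ⟨v, ht, rfl⟩)
    · simp only [size] at h
      exact Or.inr ⟨l, ⟨by omega, ht.1⟩, r, ⟨by omega, ht.2⟩, rfl⟩

theorem compactedTrees_finite (k n : ℕ) : (compactedTrees k n).Finite := by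
  refine (PointerTree.finite_size_le n n).subset ?_
  rintro c ⟨⟨t, rfl⟩, hn, -⟩
  have hg : UIDState.init.Good := by intro a b v h; simp [UIDState.init] at h
  obtain ⟨-, -, ht, hc, -⟩ := uidProc_spec t _ hg
  have : (uidProc t UIDState.init).2.2.counter = n := by
    rw [hc, ← hn]; simp [UIDState.init, compaction]
  rw [this] at ht
  exact ⟨hn.le, ht⟩

/-! Let `A_k` be the operator sending `z ^ u / u!` to the exponential generating function of the
graphs obtained from `u` recorded nodes by appending an output of the UID procedure with at most
`k` levels of right edges. Splitting the appended output at its root gives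
`(D - A_k) A_{k+1} = D ^ 2 z - z D`; the term `z D` accounts for the `u` pairs of children that are
already recorded and therefore do not create a node. Since `A_0 = D z`, it follows by induction that
`M_0 = D - A_0` and `M_{k+1} = M_k (D - A_{k+1})`. As `C_k = A_{k+1} 1` and `D ^ 2 z - z D` kills
`1`, the rightmost factor `D - A_k` of `M_k` kills `C_k`. -/

open Finset.HasAntidiagonal (antidiagonal mem_antidiagonal)

section EGFOperators

/-- The coefficient of `z ^ n / n!`, as a linear functional. -/
noncomputable def egfCoeff (n : ℕ) : PowerSeries ℚ →ₗ[ℚ] ℚ :=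
  (n.factorial : ℚ) • PowerSeries.coeff n

theorem egfCoeff_apply (n : ℕ) (f : PowerSeries ℚ) :
    egfCoeff n f = n.factorial * f.coeff n := rfl

theorem egfCoeff_ext {f g : PowerSeries ℚ} (h : ∀ n, egfCoeff n f = egfCoeff n g) : f = g := by
  ext n
  exact mul_left_cancel₀ (Nat.cast_ne_zero.2 n.factorial_ne_zero) (h n)

theorem egfCoeff_mk_div_factorial (a : ℕ → ℚ) (n : ℕ) :
    egfCoeff n (PowerSeries.mk fun m => a m / m.factorial) = a n := by
  rw [egfCoeff_apply, PowerSeries.coeff_mk,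
    mul_div_cancel₀ _ (Nat.cast_ne_zero.2 n.factorial_ne_zero)]

theorem egfCoeff_one (n : ℕ) : egfCoeff n 1 = if n = 0 then 1 else 0 := by
  rw [egfCoeff_apply, PowerSeries.coeff_one]
  split_ifs with h <;> simp [h]

theorem egfCoeff_opD (n : ℕ) (f : PowerSeries ℚ) : egfCoeff n (opD f) = egfCoeff (n + 1) f := by
  have h : (opD f).coeff n = f.coeff (n + 1) * (n + 1) := PowerSeries.coeff_derivative f n
  rw [egfCoeff_apply, egfCoeff_apply, h, Nat.factorial_succ]
  push_cast
  ring

theorem egfCoeff_succ_opZ (n : ℕ) (f : PowerSeries ℚ) :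
    egfCoeff (n + 1) (opZ f) = (n + 1) * egfCoeff n f := by
  simp only [egfCoeff_apply, opZ, LinearMap.mulLeft_apply, PowerSeries.coeff_succ_X_mul,
    Nat.factorial_succ]
  push_cast
  ring

theorem opD_mul_opZ : opD * opZ = opZ * opD + 1 := by
  ext1 f
  have h : opD (opZ f) = PowerSeries.X * opD f + f * opD PowerSeries.X :=
    (PowerSeries.derivative ℚ).leibniz PowerSeries.X f
  have hX : opD PowerSeries.X = 1 := PowerSeries.derivative_X
  rw [hX, mul_one] at h
  exact h

theorem opD_one : opD 1 = 0 :=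
  (PowerSeries.derivative ℚ).map_one_eq_zero

/-- The operator mapping `z ^ u / u!` to `∑ n, a u n * z ^ (u + n) / (u + n)!`. -/
noncomputable def opOfArray (a : ℕ → ℕ → ℚ) : Module.End ℚ (PowerSeries ℚ) where
  toFun f := PowerSeries.mk fun N =>
    (∑ p ∈ antidiagonal N, a p.1 p.2 * egfCoeff p.1 f) / N.factorial
  map_add' f g := by
    ext N
    simp only [map_add, PowerSeries.coeff_mk, mul_add, Finset.sum_add_distrib, add_div]
  map_smul' c f := by
    ext N
    simp only [map_smul, PowerSeries.coeff_mk, smul_eq_mul, RingHom.id_apply,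
      mul_left_comm _ c, ← Finset.mul_sum, mul_div_assoc]

theorem egfCoeff_opOfArray (a : ℕ → ℕ → ℚ) (N : ℕ) (f : PowerSeries ℚ) :
    egfCoeff N (opOfArray a f) = ∑ p ∈ antidiagonal N, a p.1 p.2 * egfCoeff p.1 f :=
  egfCoeff_mk_div_factorial (fun N => ∑ p ∈ antidiagonal N, a p.1 p.2 * egfCoeff p.1 f) N

theorem egfCoeff_opOfArray_one (a : ℕ → ℕ → ℚ) (N : ℕ) :
    egfCoeff N (opOfArray a 1) = a 0 N := by
  rw [egfCoeff_opOfArray, Finset.sum_eq_single (0, N)]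
  · simp [egfCoeff_one]
  · rintro ⟨u, n⟩ hp hne
    have hu : u ≠ 0 := by rintro rfl; exact hne (by simpa using hp)
    simp [egfCoeff_one, hu]
  · simp

theorem egfCoeff_opOfArray_diagonal (d : ℕ → ℚ) (N : ℕ) (f : PowerSeries ℚ) :
    egfCoeff N (opOfArray (fun u n => if n = 0 then d u else 0) f) = d N * egfCoeff N f := by
  rw [egfCoeff_opOfArray, Finset.sum_eq_single (N, 0)]
  · simp
  · rintro ⟨u, n⟩ hp hne
    have hn : n ≠ 0 := by rintro rfl; exact hne (by simpa using hp)
    simp [hn]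
  · simp

theorem opOfArray_sub (a b : ℕ → ℕ → ℚ) : opOfArray (a - b) = opOfArray a - opOfArray b := by
  refine LinearMap.ext fun f => egfCoeff_ext fun N => ?_
  simp only [LinearMap.sub_apply, map_sub, egfCoeff_opOfArray, Pi.sub_apply, sub_mul,
    Finset.sum_sub_distrib]

theorem opOfArray_mul (a b : ℕ → ℕ → ℚ) : opOfArray a * opOfArray b =
    opOfArray fun u n => ∑ p ∈ antidiagonal n, b u p.1 * a (u + p.1) p.2 := by
  refine LinearMap.ext fun f => egfCoeff_ext fun N => ?_
  simp only [Module.End.mul_apply, egfCoeff_opOfArray, Finset.mul_sum, Finset.sum_mul]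
  rw [Finset.sum_sigma', Finset.sum_sigma']
  refine Finset.sum_nbij' (fun x => ⟨(x.2.1, x.2.2 + x.1.2), (x.2.2, x.1.2)⟩)
    (fun x => ⟨(x.1.1 + x.2.1, x.2.2), (x.1.1, x.2.1)⟩) ?_ ?_ ?_ ?_ ?_ <;>
  rintro ⟨⟨_, _⟩, _, _⟩ h <;>
  simp only [Finset.mem_sigma, mem_antidiagonal] at h ⊢
  · grind
  · grind
  · grind
  · grind
  · obtain ⟨-, rfl⟩ := h
    ring

theorem opD_mul_opOfArray (a : ℕ → ℕ → ℚ) : opD * opOfArray a =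
    opD * opOfArray (fun u n => if n = 0 then a u 0 else 0) +
      opOfArray fun u n => a u (n + 1) := by
  refine LinearMap.ext fun f => egfCoeff_ext fun N => ?_
  simp only [LinearMap.add_apply, map_add, Module.End.mul_apply, egfCoeff_opD,
    egfCoeff_opOfArray_diagonal]
  rw [egfCoeff_opOfArray, Finset.Nat.sum_antidiagonal_succ', egfCoeff_opOfArray]

theorem opOfArray_diagonal_cast :
    opOfArray (fun u n => if n = 0 then (u : ℚ) else 0) = opZ * opD := by
  refine LinearMap.ext fun f => egfCoeff_ext fun N => ?_
  rw [egfCoeff_opOfArray_diagonal, Module.End.mul_apply]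
  cases N with
  | zero => simp [egfCoeff_apply, opZ]
  | succ N => rw [egfCoeff_succ_opZ, egfCoeff_opD, Nat.cast_succ]

theorem opOfArray_diagonal_cast_add_one :
    opOfArray (fun u n => if n = 0 then (u + 1 : ℚ) else 0) = opD * opZ := by
  refine LinearMap.ext fun f => egfCoeff_ext fun N => ?_
  rw [egfCoeff_opOfArray_diagonal, Module.End.mul_apply, egfCoeff_opD, egfCoeff_succ_opZ]

end EGFOperators

/-- Record a new pair of children in the table, under the next free identifier. -/
def UIDState.push (s : UIDState) (p : ℕ × ℕ) : UIDState :=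
  { s with counter := s.counter + 1, table := (p, s.counter + 1) :: s.table }

theorem UIDState.lookup_push (s : UIDState) (p q : ℕ × ℕ) :
    (s.push p).table.lookup q = if q = p then some (s.counter + 1) else s.table.lookup q := by
  by_cases h : q = p
  · simp [push, h]
  · simp [push, List.lookup_cons, h, beq_eq_false_iff_ne.2 h]

/-- The states reached by the UID procedure: children precede parents, the table is a bijection
from a set of pairs onto `{1, …, counter}`, and nothing is recorded before the first leaf. -/
structure UIDState.Complete (s : UIDState) : Prop where
  good : s.Good
  existsUnique_lookup : ∀ v, 1 ≤ v → v ≤ s.counter → ∃! p, s.table.lookup p = some v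
  counter_eq_zero : s.leafSeen = false → s.counter = 0

theorem UIDState.complete_init : UIDState.init.Complete where
  good a b v h := by simp [UIDState.init] at h
  existsUnique_lookup v h1 h2 := absurd (h1.trans h2) (by simp [UIDState.init])
  counter_eq_zero _ := rfl

namespace UIDState.Complete

variable {s : UIDState}

theorem lookup_lt (hs : s.Complete) {p : ℕ × ℕ} {v : ℕ} (h : s.table.lookup p = some v) :
    p.1 < v ∧ p.2 < v ∧ v ≤ s.counter :=
  hs.good p.1 p.2 v h

theorem leafSeen_of_counter_pos (hs : s.Complete) (h : 0 < s.counter) : s.leafSeen = true := by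
  by_contra hleaf
  exact h.ne' (hs.counter_eq_zero (by simpa using hleaf))

theorem setLeafSeen (hs : s.Complete) : ({ s with leafSeen := true } : UIDState).Complete where
  good := hs.good
  existsUnique_lookup := hs.existsUnique_lookup
  counter_eq_zero := by simp

theorem push (hs : s.Complete) (hleaf : s.leafSeen = true) {p : ℕ × ℕ}
    (hp : s.table.lookup p = none) (h1 : p.1 ≤ s.counter) (h2 : p.2 ≤ s.counter) :
    (s.push p).Complete where
  good a b v h := by
    change a < v ∧ b < v ∧ v ≤ s.counter + 1
    rw [lookup_push] at h
    split_ifs at h with hab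
    · obtain rfl := Option.some.inj h
      subst hab
      exact ⟨by omega, by omega, le_rfl⟩
    · have := hs.good a b v h
      omega
  existsUnique_lookup v hv1 (hv2 : v ≤ s.counter + 1) := by
    simp only [lookup_push]
    obtain rfl | hv := hv2.eq_or_lt
    · refine ⟨p, if_pos rfl, fun q hq => ?_⟩
      by_contra hqp
      have hq := (if_neg hqp).symm.trans hq
      have := hs.lookup_lt hq
      omega
    · obtain ⟨q, hq, huniq⟩ := hs.existsUnique_lookup v hv1 (by omega)
      have hqp : q ≠ p := by rintro rfl; simp [hp] at hq
      refine ⟨q, by simp only [if_neg hqp, hq], fun r hr => ?_⟩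
      dsimp only at hr
      split_ifs at hr
      · have := Option.some.inj hr
        omega
      · exact huniq r hr
  counter_eq_zero h := by simp [UIDState.push, hleaf] at h

theorem ncard_lookup_ne_none (hs : s.Complete) :
    {p | s.table.lookup p ≠ none}.ncard = s.counter := by
  have hbij : Set.BijOn (fun p => (s.table.lookup p).getD 0) {p | s.table.lookup p ≠ none}
      (Set.Icc 1 s.counter) := by
    refine ⟨fun p hp => ?_, fun p hp q hq hpq => ?_, fun v hv => ?_⟩
    · obtain ⟨v, hv⟩ := Option.ne_none_iff_exists'.1 hp
      have := hs.lookup_lt hv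
      simp only [hv, Option.getD_some, Set.mem_Icc]
      omega
    · obtain ⟨v, hv⟩ := Option.ne_none_iff_exists'.1 hp
      obtain ⟨w, hw⟩ := Option.ne_none_iff_exists'.1 hq
      obtain rfl : v = w := by simpa [hv, hw] using hpq
      have := hs.lookup_lt hv
      exact (hs.existsUnique_lookup v (by omega) (by omega)).unique hv hw
    · obtain ⟨p, hp, -⟩ := hs.existsUnique_lookup v hv.1 hv.2
      exact ⟨p, Option.ne_none_iff_exists'.2 ⟨v, hp⟩, by simp only [hp, Option.getD_some]⟩
  rw [hbij.ncard_eq, ← Finset.coe_Icc, Set.ncard_coe_finset, Nat.card_Icc, Nat.add_sub_cancel]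

end UIDState.Complete

namespace PointerTree

/-- The identifier of the root of a graph that the UID procedure builds from the state `s`. -/
def uid (s : UIDState) : PointerTree → ℕ
  | leaf => 0
  | pointer v => v
  | node l r => s.counter + (node l r).size

/-- The state of the UID procedure after it has built a given graph from the state `s`. -/
def after : PointerTree → UIDState → UIDState
  | leaf, s => { s with leafSeen := true }
  | pointer _, s => s
  | node l r, s => (r.after (l.after s)).push (l.uid s, r.uid (l.after s))

variable {s : UIDState} {c l r : PointerTree}

theorem counter_after (c : PointerTree) (s : UIDState) :
    (c.after s).counter = s.counter + c.size := by
  induction c generalizing s with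
  | leaf => rfl
  | pointer _ => rfl
  | node l r ihl ihr =>
    simp only [after, UIDState.push, size, ihl, ihr]
    omega

theorem uid_eq_counter_after (h : c.size ≠ 0) : c.uid s = (c.after s).counter := by
  cases c with
  | leaf => exact absurd rfl h
  | pointer _ => exact absurd rfl h
  | node l r => exact (counter_after _ _).symm

theorem after_of_size_eq_zero (hleaf : s.leafSeen = true) (h : c.size = 0) : c.after s = s := by
  cases c with
  | leaf => cases s; simp_all [after]
  | pointer _ => rfl
  | node l r => simp [size] at h

/-- A node that has just been created carries the largest identifier, so it is not a child in any
recorded pair: only pairs without new nodes can be met again. -/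
theorem size_eq_zero_of_lookup_eq_some {v : ℕ} (hs : (r.after (l.after s)).Complete)
    (h : (r.after (l.after s)).table.lookup (l.uid s, r.uid (l.after s)) = some v) :
    l.size = 0 ∧ r.size = 0 := by
  obtain ⟨hl, hr, hv⟩ := hs.lookup_lt h
  dsimp only at hl hr
  rw [counter_after] at hv
  have hr0 : r.size = 0 := by
    by_contra h0
    have := uid_eq_counter_after (s := l.after s) h0
    rw [counter_after] at this
    omega
  refine ⟨?_, hr0⟩
  by_contra h0
  have := uid_eq_counter_after (s := s) h0
  omega

theorem after_eq_of_lookup_eq_some {v : ℕ} (hs : s.Complete) (hs' : (r.after (l.after s)).Complete)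
    (h : (r.after (l.after s)).table.lookup (l.uid s, r.uid (l.after s)) = some v) :
    s.leafSeen = true ∧ l.after s = s ∧ r.after s = s := by
  obtain ⟨hl, hr⟩ := size_eq_zero_of_lookup_eq_some hs' h
  have hlt := hs'.lookup_lt h
  simp only [counter_after] at hlt
  have hleaf : s.leafSeen = true := hs.leafSeen_of_counter_pos (by omega)
  exact ⟨hleaf, after_of_size_eq_zero hleaf hl, after_of_size_eq_zero hleaf hr⟩

/-- The graph `c` is an output of the UID procedure started in the state `s`. -/
def IsOutput (s : UIDState) (c : PointerTree) : Prop := ∃ t : FullBinaryTree, (uidProc t s).1 = c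

end PointerTree

open PointerTree

theorem uidProc_node_of_eq {tl tr : FullBinaryTree} {s s₁ s₂ : UIDState} {l r : PointerTree}
    {a b : ℕ} (hl : uidProc tl s = (l, a, s₁)) (hr : uidProc tr s₁ = (r, b, s₂)) :
    uidProc (.node () tl tr) s =
      match s₂.table.lookup (a, b) with
      | some v => (.pointer v, v, s₂)
      | none => (.node l r, s₂.counter + 1, s₂.push (a, b)) := by
  simp only [uidProc, hl, hr]
  rfl

theorem exists_uidProc_eq (t : FullBinaryTree) {s : UIDState} (hs : s.Complete) :
    ∃ c : PointerTree, uidProc t s = (c, c.uid s, c.after s) ∧ (c.after s).Complete ∧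
      (c.after s).leafSeen = true ∧ c.uid s ≤ (c.after s).counter := by
  induction t generalizing s with
  | nil =>
    cases hleaf : s.leafSeen with
    | false =>
      exact ⟨leaf, by simp [uidProc, hleaf, uid, after], hs.setLeafSeen, rfl, Nat.zero_le _⟩
    | true =>
      refine ⟨pointer 0, ?_, hs, hleaf, Nat.zero_le _⟩
      cases s
      simp_all [uidProc, uid, after]
  | node _ tl tr ihl ihr =>
    obtain ⟨l, hl, hs₁, -, hul⟩ := ihl hs
    obtain ⟨r, hr, hs₂, hleaf, hur⟩ := ihr hs₁
    rw [uidProc_node_of_eq hl hr]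
    cases hlook : (r.after (l.after s)).table.lookup (l.uid s, r.uid (l.after s)) with
    | some v =>
      have hv := (hs₂.lookup_lt hlook).2.2
      obtain ⟨hleaf', hl', hr'⟩ := after_eq_of_lookup_eq_some hs hs₂ hlook
      rw [hl', hr'] at hv ⊢
      exact ⟨pointer v, rfl, hs, hleaf', hv⟩
    | none =>
      have hcounter := counter_after r (l.after s)
      have huid : (node l r).uid s = (r.after (l.after s)).counter + 1 := by
        simp only [uid, size, counter_after]
        omega
      refine ⟨node l r, by rw [huid]; rfl, hs₂.push hleaf hlook ?_ hur, hleaf, huid.le⟩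
      dsimp only
      omega

namespace PointerTree.IsOutput

variable {s : UIDState} {c : PointerTree}

theorem exists_uidProc_eq (h : c.IsOutput s) (hs : s.Complete) :
    ∃ t, uidProc t s = (c, c.uid s, c.after s) := by
  obtain ⟨t, rfl⟩ := h
  obtain ⟨c, ht, -⟩ := _root_.exists_uidProc_eq t hs
  rw [ht]
  exact ⟨t, ht⟩

theorem complete_after (h : c.IsOutput s) (hs : s.Complete) : (c.after s).Complete := by
  obtain ⟨t, rfl⟩ := h
  obtain ⟨c, ht, hc, -⟩ := _root_.exists_uidProc_eq t hs
  rwa [ht]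

theorem leafSeen_after (h : c.IsOutput s) (hs : s.Complete) : (c.after s).leafSeen = true := by
  obtain ⟨t, rfl⟩ := h
  obtain ⟨c, ht, -, hc, -⟩ := _root_.exists_uidProc_eq t hs
  rwa [ht]

theorem targetsLE (h : c.IsOutput s) (hs : s.Complete) : c.TargetsLE (s.counter + c.size) := by
  obtain ⟨t, rfl⟩ := h
  obtain ⟨-, -, htargets, hcounter, -⟩ := uidProc_spec t s hs.good
  rwa [← hcounter]

end PointerTree.IsOutput

theorem PointerTree.isOutput_leaf_iff {s : UIDState} : leaf.IsOutput s ↔ s.leafSeen = false := by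
  constructor
  · rintro ⟨_ | ⟨_, tl, tr⟩, ht⟩
    · by_contra h
      simp_all [uidProc]
    · rw [uidProc_node_of_eq rfl rfl] at ht
      split at ht <;> cases ht
  · intro h
    exact ⟨.nil, by simp [uidProc, h]⟩

namespace UIDState.Complete

variable {s : UIDState} {l r : PointerTree}

theorem isOutput_node_iff (hs : s.Complete) : (node l r).IsOutput s ↔
    l.IsOutput s ∧ r.IsOutput (l.after s) ∧
      (r.after (l.after s)).table.lookup (l.uid s, r.uid (l.after s)) = none := by
  constructor
  · rintro ⟨_ | ⟨_, tl, tr⟩, ht⟩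
    · cases h : s.leafSeen <;> simp [uidProc, h] at ht
    · obtain ⟨l', hl, hs₁, -⟩ := exists_uidProc_eq tl hs
      obtain ⟨r', hr, -⟩ := exists_uidProc_eq tr hs₁
      rw [uidProc_node_of_eq hl hr] at ht
      split at ht
      · cases ht
      next hlook =>
        obtain ⟨rfl, rfl⟩ := node.inj ht
        exact ⟨⟨tl, by rw [hl]⟩, ⟨tr, by rw [hr]⟩, hlook⟩
  · rintro ⟨hl, hr, hlook⟩
    obtain ⟨tl, htl⟩ := hl.exists_uidProc_eq hs
    obtain ⟨tr, htr⟩ := hr.exists_uidProc_eq (hl.complete_after hs)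
    exact ⟨.node () tl tr, by rw [uidProc_node_of_eq htl htr, hlook]⟩

theorem isOutput_pointer (hs : s.Complete) (hleaf : s.leafSeen = true) {v : ℕ}
    (hv : v ≤ s.counter) : (pointer v).IsOutput s := by
  induction v using Nat.strong_induction_on with
  | _ v ih =>
    obtain rfl | hpos := Nat.eq_zero_or_pos v
    · exact ⟨.nil, by simp [uidProc, hleaf]⟩
    · obtain ⟨p, hp, -⟩ := hs.existsUnique_lookup v hpos hv
      obtain ⟨h1, h2, -⟩ := hs.lookup_lt hp
      obtain ⟨tl, htl⟩ := (ih p.1 h1 (by omega)).exists_uidProc_eq hs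
      obtain ⟨tr, htr⟩ := (ih p.2 h2 (by omega)).exists_uidProc_eq hs
      refine ⟨.node () tl tr, ?_⟩
      simp only [uidProc_node_of_eq htl htr, uid, after, hp]

theorem isOutput_pointer_iff (hs : s.Complete) {v : ℕ} :
    (pointer v).IsOutput s ↔ s.leafSeen = true ∧ v ≤ s.counter :=
  ⟨fun h => ⟨h.leafSeen_after hs, h.targetsLE hs⟩, fun h => hs.isOutput_pointer h.1 h.2⟩

end UIDState.Complete

section Counting

/-- The maximal number of nodes reached on a spine path by taking right edges, counting the root:
`0` for an empty spine, and one more than the right height otherwise. -/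
def PointerTree.rightLevels : PointerTree → ℕ
  | leaf => 0
  | pointer _ => 0
  | node l r => max l.rightLevels (r.rightLevels + 1)

theorem PointerTree.rightHeight_spine (c : PointerTree) :
    rightHeight c.spine = c.rightLevels - 1 := by
  induction c with
  | leaf => rfl
  | pointer _ => rfl
  | node l r ihl ihr =>
    cases r with
    | leaf | pointer _ | node _ _ =>
      simp only [spine, rightHeight, rightLevels] at ihl ihr ⊢
      omega

/-- The outputs of the UID procedure from the state `s`, of size `n` with at most `k` right
levels. -/
def outputs (k : ℕ) (s : UIDState) (n : ℕ) : Set PointerTree :=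
  {c | c.IsOutput s ∧ c.size = n ∧ c.rightLevels ≤ k}

/-- The pairs of graphs built by the UID procedure for two consecutive subtrees, of total size `n`,
that are small enough to be the children of a node with at most `k + 1` right levels. Such a
node is created only if the pair is not in the table yet. -/
def childPairs (k : ℕ) (s : UIDState) (n : ℕ) : Set (PointerTree × PointerTree) :=
  {x | x.1.IsOutput s ∧ x.2.IsOutput (x.1.after s) ∧ x.1.size + x.2.size = n ∧
    x.1.rightLevels ≤ k + 1 ∧ x.2.rightLevels ≤ k}

/-- The identifier of a pair of consecutive graphs built from the state `s`, if the pair is in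
the table. -/
def lookupPair (s : UIDState) (x : PointerTree × PointerTree) : Option ℕ :=
  (x.2.after (x.1.after s)).table.lookup (x.1.uid s, x.2.uid (x.1.after s))

variable {s : UIDState}

theorem outputs_finite (hs : s.Complete) (k n : ℕ) : (outputs k s n).Finite := by
  refine (finite_size_le (s.counter + n) n).subset ?_
  rintro c ⟨h, rfl, -⟩
  exact ⟨le_rfl, h.targetsLE hs⟩

theorem ncard_outputs_size_zero (hs : s.Complete) (k : ℕ) :
    (outputs k s 0).ncard = s.counter + 1 := by
  cases hleaf : s.leafSeen with
  | false =>
    have h : outputs k s 0 = {leaf} := by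
      ext (_ | _ | _) <;>
        simp [outputs, isOutput_leaf_iff, hs.isOutput_pointer_iff, hleaf, size, rightLevels]
    rw [h, Set.ncard_singleton, hs.counter_eq_zero hleaf]
  | true =>
    have h : outputs k s 0 = pointer '' (Finset.range (s.counter + 1) : Set ℕ) := by
      ext (_ | _ | _) <;>
        simp [outputs, isOutput_leaf_iff, hs.isOutput_pointer_iff, hleaf, size, rightLevels]
    rw [h, Set.ncard_image_of_injective _ fun _ _ => pointer.inj, Set.ncard_coe_finset,
      Finset.card_range]

theorem outputs_zero_succ (s : UIDState) (n : ℕ) : outputs 0 s (n + 1) = ∅ := by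
  ext (_ | _ | _) <;> simp [outputs, size, rightLevels]

theorem outputs_succ_succ (hs : s.Complete) (k n : ℕ) : outputs (k + 1) s (n + 1) =
    (fun x => node x.1 x.2) '' {x ∈ childPairs k s n | lookupPair s x = none} := by
  ext (_ | _ | ⟨l, r⟩)
  · simp [outputs, size]
  · simp [outputs, size]
  · simp only [outputs, childPairs, lookupPair, hs.isOutput_node_iff, size, rightLevels,
      Set.mem_ofPred_eq, Set.mem_image, Prod.exists, node.injEq]
    grind

theorem lookupPair_ne_none_size_zero (hs : s.Complete) (k : ℕ) :
    {x ∈ childPairs k s 0 | lookupPair s x ≠ none} =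
      Prod.map pointer pointer '' {p | s.table.lookup p ≠ none} := by
  ext ⟨l, r⟩
  constructor
  · rintro ⟨⟨hl, hr, hsize, -⟩, hlook⟩
    obtain ⟨v, hv⟩ := Option.ne_none_iff_exists'.1 hlook
    have hs₁ := hl.complete_after hs
    obtain ⟨hleaf, hl', hr'⟩ := after_eq_of_lookup_eq_some hs (hr.complete_after hs₁) hv
    dsimp only [lookupPair] at hr hsize hlook
    rw [hl'] at hr hlook
    rw [hr'] at hlook
    rcases l with _ | a | _
    · simp [isOutput_leaf_iff, hleaf] at hl
    · rcases r with _ | b | _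
      · simp [isOutput_leaf_iff, hleaf] at hr
      · exact ⟨(a, b), hlook, rfl⟩
      · simp [size] at hsize
    · simp [size] at hsize
  · rintro ⟨⟨a, b⟩, hab, ⟨⟩⟩
    obtain ⟨v, hv⟩ := Option.ne_none_iff_exists'.1 hab
    obtain ⟨ha, hb, hle⟩ := hs.lookup_lt hv
    have hleaf := hs.leafSeen_of_counter_pos (by omega)
    exact ⟨⟨hs.isOutput_pointer hleaf (by omega), hs.isOutput_pointer hleaf (by omega), rfl,
      Nat.zero_le _, Nat.zero_le _⟩, hab⟩

theorem ncard_lookupPair_ne_none (hs : s.Complete) (k n : ℕ) :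
    {x ∈ childPairs k s n | lookupPair s x ≠ none}.ncard = if n = 0 then s.counter else 0 := by
  split_ifs with hn
  · subst hn
    rw [lookupPair_ne_none_size_zero hs, Set.ncard_image_of_injective, hs.ncard_lookup_ne_none]
    exact Function.Injective.prodMap (fun _ _ => pointer.inj) fun _ _ => pointer.inj
  · have hempty : {x ∈ childPairs k s n | lookupPair s x ≠ none} = ∅ := by
      refine Set.eq_empty_of_forall_notMem fun x ⟨⟨hl, hr, hsize, _⟩, hlook⟩ => hn ?_
      obtain ⟨v, hv⟩ := Option.ne_none_iff_exists'.1 hlook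
      have := size_eq_zero_of_lookup_eq_some (hr.complete_after (hl.complete_after hs)) hv
      omega
    rw [hempty, Set.ncard_empty]

/-- A pair of consecutive outputs, sorted by the sizes of its components. -/
def childPairsEquiv (k : ℕ) (s : UIDState) (n : ℕ) : childPairs k s n ≃
    Σ p : antidiagonal n, Σ l : outputs (k + 1) s p.1.1, outputs k (l.1.after s) p.1.2 where
  toFun x := ⟨⟨(x.1.1.size, x.1.2.size), mem_antidiagonal.2 x.2.2.2.1⟩,
    ⟨x.1.1, x.2.1, rfl, x.2.2.2.2.1⟩, x.1.2, x.2.2.1, rfl, x.2.2.2.2.2⟩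
  invFun y := ⟨(y.2.1.1, y.2.2.1), y.2.1.2.1, y.2.2.2.1,
    by rw [y.2.1.2.2.1, y.2.2.2.2.1]; exact mem_antidiagonal.1 y.1.2, y.2.1.2.2.2, y.2.2.2.2.2⟩
  left_inv _ := rfl
  right_inv := by
    rintro ⟨⟨⟨i, j⟩, hp⟩, ⟨l, hl, hi, hl'⟩, ⟨r, hr, hj, hr'⟩⟩
    obtain rfl : l.size = i := hi
    obtain rfl : r.size = j := hj
    rfl

theorem childPairs_finite (hs : s.Complete) (k n : ℕ) : (childPairs k s n).Finite := by
  have (i : ℕ) : Finite (outputs (k + 1) s i) := outputs_finite hs _ _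
  have (i j : ℕ) (l : outputs (k + 1) s i) : Finite (outputs k (l.1.after s) j) :=
    outputs_finite (l.2.1.complete_after hs) _ _
  exact Finite.of_equiv _ (childPairsEquiv k s n).symm

theorem ncard_childPairs (hs : s.Complete) (k n : ℕ) {a : ℕ → ℕ → ℚ}
    (ha : ∀ s' : UIDState, s'.Complete → ∀ j, ((outputs k s' j).ncard : ℚ) = a s'.counter j) :
    ((childPairs k s n).ncard : ℚ) =
      ∑ p ∈ antidiagonal n, ((outputs (k + 1) s p.1).ncard : ℚ) * a (s.counter + p.1) p.2 := by
  have (i : ℕ) : Fintype (outputs (k + 1) s i) := (outputs_finite hs _ _).fintype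
  have (i j : ℕ) (l : outputs (k + 1) s i) : Finite (outputs k (l.1.after s) j) :=
    outputs_finite (l.2.1.complete_after hs) _ _
  have hfiber (i j : ℕ) (l : outputs (k + 1) s i) :
      (Nat.card (outputs k (l.1.after s) j) : ℚ) = a (s.counter + i) j := by
    rw [Nat.card_coe_set_eq, ha _ (l.2.1.complete_after hs), counter_after, l.2.2.1]
  rw [← Nat.card_coe_set_eq, Nat.card_congr (childPairsEquiv k s n), Nat.card_sigma,
    Nat.cast_sum, ← Finset.sum_coe_sort (antidiagonal n)]
  refine Finset.sum_congr rfl fun p _ => ?_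
  simp only [Nat.card_sigma, Nat.cast_sum, hfiber, Finset.sum_const, Finset.card_univ,
    nsmul_eq_mul, ← Nat.card_coe_set_eq, Nat.card_eq_fintype_card]

theorem ncard_outputs_succ_succ (hs : s.Complete) (k n : ℕ) :
    ((outputs (k + 1) s (n + 1)).ncard : ℚ) =
      (childPairs k s n).ncard - if n = 0 then (s.counter : ℚ) else 0 := by
  have hnew : (outputs (k + 1) s (n + 1)).ncard =
      {x ∈ childPairs k s n | lookupPair s x = none}.ncard := by
    rw [outputs_succ_succ hs]
    exact Set.ncard_image_of_injective _ fun _ _ h => Prod.ext_iff.2 (node.inj h)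
  have hsplit := Set.ncard_inter_add_ncard_sdiff_eq_ncard (childPairs k s n)
    {x | lookupPair s x = none} (childPairs_finite hs k n)
  have hold : (childPairs k s n \ {x | lookupPair s x = none}).ncard =
    if n = 0 then s.counter else 0 := ncard_lookupPair_ne_none hs k n
  rw [hnew, ← hsplit, hold]
  push_cast
  exact (add_sub_cancel_right _ _).symm

end Counting

/-- The array of output counts: `outputCount k u n` is the number of graphs with `n` internal
nodes and at most `k` right levels that the UID procedure can append to `u` recorded nodes. The
values are rational because the recursion subtracts the `u` pairs of children recorded before. -/
def outputCount : ℕ → ℕ → ℕ → ℚ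
  | _, u, 0 => u + 1
  | 0, _, _ + 1 => 0
  | k + 1, u, n + 1 =>
      (∑ i : Fin (n + 1), outputCount (k + 1) u i * outputCount k (u + i) (n - i)) -
        if n = 0 then (u : ℚ) else 0
  termination_by k _ n => (k, n)

theorem outputCount_size_zero (k u : ℕ) : outputCount k u 0 = u + 1 := by
  rw [outputCount]

theorem outputCount_zero (u n : ℕ) : outputCount 0 u n = if n = 0 then (u + 1 : ℚ) else 0 := by
  cases n <;> simp [outputCount]

theorem outputCount_succ_succ (k u n : ℕ) : outputCount (k + 1) u (n + 1) =
    (∑ p ∈ antidiagonal n, outputCount (k + 1) u p.1 * outputCount k (u + p.1) p.2) -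
      if n = 0 then (u : ℚ) else 0 := by
  rw [outputCount, Finset.Nat.sum_antidiagonal_eq_sum_range_succ_mk, Finset.sum_range]

theorem ncard_outputs (k : ℕ) {s : UIDState} (hs : s.Complete) (n : ℕ) :
    ((outputs k s n).ncard : ℚ) = outputCount k s.counter n := by
  induction k generalizing s n with
  | zero =>
    cases n with
    | zero => rw [ncard_outputs_size_zero hs, outputCount_size_zero, Nat.cast_succ]
    | succ n => simp [outputs_zero_succ, outputCount_zero]
  | succ k ihk =>
    induction n using Nat.strong_induction_on with
    | _ n ihn =>
      cases n with
      | zero => rw [ncard_outputs_size_zero hs, outputCount_size_zero, Nat.cast_succ]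
      | succ n =>
        rw [ncard_outputs_succ_succ hs, ncard_childPairs hs k n fun s' hs' => ihk hs',
          outputCount_succ_succ]
        congr 1
        refine Finset.sum_congr rfl fun p hp => ?_
        rw [mem_antidiagonal] at hp
        rw [ihn p.1 (by omega)]

theorem compactedTrees_eq_outputs (k n : ℕ) :
    compactedTrees k n = outputs (k + 1) UIDState.init n := by
  ext c
  simp only [compactedTrees, outputs, Set.mem_ofPred_eq, rightHeight_spine, Nat.sub_le_iff_le_add]
  rfl

theorem numCompactedTrees_eq_outputCount (k n : ℕ) :
    (numCompactedTrees k n : ℚ) = outputCount (k + 1) 0 n := by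
  rw [numCompactedTrees, compactedTrees_eq_outputs, ncard_outputs _ UIDState.complete_init]
  rfl

/-- The operator that appends an output with at most `k` right levels, where `z ^ u / u!` stands
for a graph with `u` recorded nodes. -/
noncomputable def opAppend (k : ℕ) : Module.End ℚ (PowerSeries ℚ) := opOfArray (outputCount k)

theorem opAppend_zero : opAppend 0 = opD * opZ := by
  rw [opAppend, ← opOfArray_diagonal_cast_add_one]
  congr 1
  ext u n
  exact outputCount_zero u n

theorem opD_sub_opAppend_mul (k : ℕ) :
    (opD - opAppend k) * opAppend (k + 1) = opD ^ 2 * opZ - opZ * opD := by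
  have hshift : opOfArray (fun u n => outputCount (k + 1) u (n + 1)) =
      opAppend k * opAppend (k + 1) - opZ * opD := by
    rw [opAppend, opAppend, opOfArray_mul, ← opOfArray_diagonal_cast, ← opOfArray_sub]
    congr 1
    ext u n
    exact outputCount_succ_succ k u n
  have hderiv : opD * opAppend (k + 1) =
      opD ^ 2 * opZ + (opAppend k * opAppend (k + 1) - opZ * opD) := by
    rw [← hshift, opAppend, opD_mul_opOfArray]
    simp only [outputCount_size_zero, opOfArray_diagonal_cast_add_one, pow_two, mul_assoc]
  rw [sub_mul, hderiv]
  abel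

theorem opM_zero : opM 0 = opD - opAppend 0 := by
  rw [opM, opAppend_zero, opD_mul_opZ, sub_mul, one_mul]
  abel

theorem opD_sq_mul_opZ : opD ^ 2 * opZ = opZ * opD ^ 2 + 2 * opD := by
  rw [pow_two, mul_assoc, opD_mul_opZ, mul_add, ← mul_assoc, opD_mul_opZ]
  noncomm_ring

theorem opM_one : opM 1 = opM 0 * opD - (opD ^ 2 * opZ - opZ * opD) := by
  have h3 : (3 : Module.End ℚ (PowerSeries ℚ)) = 2 + 1 := by norm_num
  rw [opM, opM, opD_sq_mul_opZ, h3]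
  simp only [sub_mul, add_mul, one_mul, two_mul, pow_two, mul_assoc]
  abel

theorem opM_succ (k : ℕ) : opM (k + 1) = opM k * (opD - opAppend (k + 1)) := by
  induction k with
  | zero => rw [zero_add, opM_one, mul_sub, ← opD_sub_opAppend_mul 0, ← opM_zero]
  | succ k ih => rw [opM, ← opD_sub_opAppend_mul (k + 1), ← mul_assoc, ← ih, ← mul_sub]

theorem opM_opAppend_one (k : ℕ) : opM k (opAppend (k + 1) 1) = 0 := by
  have hk : (opD - opAppend k) (opAppend (k + 1) 1) = 0 := by
    rw [← Module.End.mul_apply, opD_sub_opAppend_mul, opD_sq_mul_opZ]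
    simp [pow_two, opD_one]
  cases k with
  | zero => rw [opM_zero, hk]
  | succ k => rw [opM_succ, Module.End.mul_apply, hk, map_zero]

theorem compactedEGF_eq_opAppend_one (k : ℕ) : compactedEGF k = opAppend (k + 1) 1 := by
  refine egfCoeff_ext fun N => ?_
  rw [compactedEGF, egfCoeff_mk_div_factorial, opAppend, egfCoeff_opOfArray_one,
    numCompactedTrees_eq_outputCount]

theorem theorem8p5 (k : ℕ) : opM k (compactedEGF k) = 0 := by
  rw [compactedEGF_eq_opAppend_one, opM_opAppend_one]
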